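/- **Theorem.** Let $\mathbb D$ be the open unit disc of $\mathbb C$ and let $\beta=(\beta_n)_{n\ge 0}$ be a sequence of positive numbers with $\liminf_{n\to\infty}\beta_n^{1/n}\ge 1$. Let $H^2(\beta)$ be the Hilbert space of analytic functions $f(z)=\sum_{n\ge0}a_nz^n$ on $\mathbb D$ with $\|f\|^2=\sum_{n\ge0}|a_n|^2\beta_n<\infty$. For an analytic map $\varphi\colon\mathbb D\to\mathbb D$ let $C_\varphi f=f\circ\varphi$, and for $a\in\mathbb D$ let $T_a(z)=\frac{a+z}{1+\bar a z}$. Suppose that $C_{T_a}$ is a bounded operator on $H^2(\beta)$ for every $a\in\mathbb D$, and let $\varphi\colon\mathbb D\to\mathbb D$ be a non-constant analytic map such that $C_\varphi$ is a compact operator on $H^2(\beta)$. Then the Denjoy–Wolff point of $\varphi$ lies in $\mathbb D$ and is a fixed point of $\varphi$: there is exactly one point $p$ of the closed unit disc such that the iterates $\varphi^{n}=\varphi\circ\cdots\circ\varphi$ ($n$ times) converge to $p$ uniformly on compact subsets of $\mathbb D$ as $n\to\infty$, and this point satisfies $p\in\mathbb D$ and $\varphi(p)=p$. -/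

import Mathlib

open Filter Topology
open scoped ENNReal Complex.UnitDisc ComplexConjugate

noncomputable section

/-- A weight: a sequence of positive numbers `β` with `liminf β_n ^ (1/n) ≥ 1`.
The liminf is taken in `[0, ∞]`, so that it may be infinite. -/
structure Weight where
  toFun : ℕ → ℝ
  pos : ∀ n, 0 < toFun n
  one_le_liminf : 1 ≤ liminf (fun n : ℕ => ENNReal.ofReal (toFun n ^ (1 / (n : ℝ)))) atTop

instance : CoeFun Weight (fun _ => ℕ → ℝ) := ⟨Weight.toFun⟩

/-- Extension by zero to the complex plane of a function on the open unit disc. -/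
def discExt (f : 𝔻 → ℂ) (z : ℂ) : ℂ :=
  open Classical in if h : ‖z‖ < 1 then f (Complex.UnitDisc.mk z h) else 0

/-- `f` is analytic (holomorphic) on the open unit disc. -/
def IsAnalyticOnDisc (f : 𝔻 → ℂ) : Prop :=
  DifferentiableOn ℂ (discExt f) (Metric.ball 0 1)

/-- The `n`-th Taylor coefficient at the origin of a function on the open unit disc. -/
def taylorCoeff (f : 𝔻 → ℂ) (n : ℕ) : ℂ :=
  iteratedDeriv n (discExt f) 0 / (n.factorial : ℂ)

theorem discExt_coe (f : 𝔻 → ℂ) (z : 𝔻) : discExt f z = f z := by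
  simp [discExt, z.norm_lt_one]

theorem discExt_zero : discExt (0 : 𝔻 → ℂ) = 0 := by
  funext z; simp [discExt]

theorem discExt_add (f g : 𝔻 → ℂ) : discExt (f + g) = discExt f + discExt g := by
  funext z; by_cases h : ‖z‖ < 1 <;> simp [discExt, h]

theorem discExt_smul (c : ℂ) (f : 𝔻 → ℂ) : discExt (c • f) = c • discExt f := by
  funext z; by_cases h : ‖z‖ < 1 <;> simp [discExt, h]

theorem IsAnalyticOnDisc.contDiffAt {f : 𝔻 → ℂ} (hf : IsAnalyticOnDisc f) (n : ℕ) :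
    ContDiffAt ℂ n (discExt f) 0 :=
  (hf.analyticAt (Metric.ball_mem_nhds 0 one_pos)).contDiffAt

theorem taylorCoeff_zero (n : ℕ) : taylorCoeff 0 n = 0 := by
  have h : (0 : ℂ → ℂ) = fun _ => 0 := rfl
  simp [taylorCoeff, discExt_zero, h]

theorem taylorCoeff_add {f g : 𝔻 → ℂ} (hf : IsAnalyticOnDisc f) (hg : IsAnalyticOnDisc g)
    (n : ℕ) : taylorCoeff (f + g) n = taylorCoeff f n + taylorCoeff g n := by
  simp only [taylorCoeff, discExt_add]
  rw [iteratedDeriv_add (hf.contDiffAt n) (hg.contDiffAt n), add_div]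

theorem taylorCoeff_smul (c : ℂ) {f : 𝔻 → ℂ} (hf : IsAnalyticOnDisc f) (n : ℕ) :
    taylorCoeff (c • f) n = c * taylorCoeff f n := by
  simp only [taylorCoeff, discExt_smul]
  rw [iteratedDeriv_const_smul (hf.contDiffAt n) c, smul_eq_mul, mul_div_assoc]

/-- The Taylor series of an analytic function on the disc converges to it. -/
theorem hasSum_taylorCoeff {f : 𝔻 → ℂ} (hf : IsAnalyticOnDisc f) (z : 𝔻) :
    HasSum (fun n => taylorCoeff f n * (z : ℂ) ^ n) (f z) := by
  have h := Complex.hasSum_taylorSeries_on_ball (r := 1) (f := discExt f) (c := 0)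
    (by simpa [IsAnalyticOnDisc] using hf) (z := (z : ℂ)) (by simpa using z.norm_lt_one)
  rw [discExt_coe] at h
  refine h.congr_fun ?_
  intro n
  simp [taylorCoeff, div_eq_inv_mul]
  ring

/-- Square-summability against the weight, in the orthonormal coordinates `√β_n a_n`. -/
theorem memlp_coeff_iff (β : Weight) (a : ℕ → ℂ) :
    Memℓp (fun n => (Real.sqrt (β n) : ℂ) * a n) 2 ↔ Summable (fun n => ‖a n‖ ^ 2 * β n) := by
  rw [memℓp_gen_iff (by norm_num)]
  refine summable_congr fun n => ?_
  have h := Real.sq_sqrt (β.pos n).le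
  have h' : ‖(Real.sqrt (β n) : ℂ)‖ = Real.sqrt (β n) := by
    simp [abs_of_nonneg (Real.sqrt_nonneg _)]
  simp only [norm_mul, h', ENNReal.toReal_ofNat, Real.rpow_ofNat, mul_pow, h]
  ring

/-- The vector space of analytic functions `f(z) = ∑ a_n z^n` on the unit disc such that
`∑ |a_n|² β_n < ∞`. -/
def weightedHardySubmodule (β : Weight) : Submodule ℂ (𝔻 → ℂ) where
  carrier := {f | IsAnalyticOnDisc f ∧ Summable (fun n => ‖taylorCoeff f n‖ ^ 2 * β n)}
  zero_mem' := by
    refine ⟨?_, ?_⟩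
    · rw [IsAnalyticOnDisc, discExt_zero]
      exact differentiableOn_const 0
    · simp [taylorCoeff_zero, summable_zero]
  add_mem' := by
    rintro f g ⟨hf, hf'⟩ ⟨hg, hg'⟩
    refine ⟨?_, ?_⟩
    · rw [IsAnalyticOnDisc, discExt_add]
      exact DifferentiableOn.add hf hg
    · rw [← memlp_coeff_iff] at hf' hg' ⊢
      convert hf'.add hg' using 1
      funext n
      simp [taylorCoeff_add hf hg, mul_add]
  smul_mem' := by
    rintro c f ⟨hf, hf'⟩
    refine ⟨?_, ?_⟩
    · rw [IsAnalyticOnDisc, discExt_smul]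
      exact DifferentiableOn.const_smul hf c
    · rw [← memlp_coeff_iff] at hf' ⊢
      convert hf'.const_smul c using 1
      funext n
      simp [taylorCoeff_smul c hf]
      ring

/-- The weighted Hardy space `H²(β)`. This is a separate type, so that its only topology is the
one of the norm `‖f‖² = ∑ |a_n|² β_n` (not pointwise convergence). -/
def WeightedHardy (β : Weight) : Type := weightedHardySubmodule β

namespace WeightedHardy

variable {β : Weight}

instance : AddCommGroup (WeightedHardy β) :=
  inferInstanceAs (AddCommGroup (weightedHardySubmodule β))

instance : Module ℂ (WeightedHardy β) :=
  inferInstanceAs (Module ℂ (weightedHardySubmodule β))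

/-- Elements of `H²(β)` are functions on the disc. -/
instance : CoeFun (WeightedHardy β) (fun _ => 𝔻 → ℂ) := ⟨fun f => f.1⟩

/-- The orthonormal coordinates `(√β_n a_n)` of `f(z) = ∑ a_n z^n`. -/
def coords (β : Weight) : WeightedHardy β →ₗ[ℂ] lp (fun _ : ℕ => ℂ) 2 where
  toFun f := ⟨fun n => (Real.sqrt (β n) : ℂ) * taylorCoeff f n, (memlp_coeff_iff β _).2 f.2.2⟩
  map_add' f g := by
    ext n
    change (Real.sqrt (β n) : ℂ) * taylorCoeff (f.1 + g.1) n = _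
    rw [taylorCoeff_add f.2.1 g.2.1, mul_add]
    rfl
  map_smul' c f := by
    ext n
    change (Real.sqrt (β n) : ℂ) * taylorCoeff (c • f.1) n =
      c * ((Real.sqrt (β n) : ℂ) * taylorCoeff f.1 n)
    rw [taylorCoeff_smul c f.2.1]
    ring

theorem coords_injective (β : Weight) : Function.Injective (coords β) := by
  intro f g h
  apply Subtype.ext
  funext z
  have hc : ∀ n, taylorCoeff f n = taylorCoeff g n := by
    intro n
    have h1 : (Real.sqrt (β n) : ℂ) * taylorCoeff f n = (Real.sqrt (β n) : ℂ) * taylorCoeff g n :=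
      congrArg (fun x : lp (fun _ : ℕ => ℂ) 2 => x n) h
    have h2 : (Real.sqrt (β n) : ℂ) ≠ 0 := by
      exact_mod_cast (Real.sqrt_pos.2 (β.pos n)).ne'
    exact mul_left_cancel₀ h2 h1
  have hf := hasSum_taylorCoeff f.2.1 z
  have hg := hasSum_taylorCoeff g.2.1 z
  simp only [hc] at hf
  exact hf.unique hg

instance : NormedAddCommGroup (WeightedHardy β) :=
  NormedAddCommGroup.induced (WeightedHardy β) (lp (fun _ : ℕ => ℂ) 2) (coords β)
    (coords_injective β)

instance : InnerProductSpace ℂ (WeightedHardy β) where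
  norm_smul_le c f := by
    change ‖coords β (c • f)‖ ≤ ‖c‖ * ‖coords β f‖
    rw [map_smul, norm_smul]
  inner f g := inner ℂ (coords β f) (coords β g)
  norm_sq_eq_re_inner f := norm_sq_eq_re_inner (𝕜 := ℂ) (coords β f)
  conj_inner_symm f g := inner_conj_symm (coords β f) (coords β g)
  add_left f g h := by simp
  smul_left f g c := by simp [mul_comm]

/-- The norm of `H²(β)` is the one of the definition: `‖f‖² = ∑ |a_n|² β_n`. -/
theorem norm_sq_eq (f : WeightedHardy β) :
    ‖f‖ ^ 2 = ∑' n, ‖taylorCoeff f n‖ ^ 2 * β n := by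
  have h0 : ‖f‖ = ‖coords β f‖ := rfl
  have h := lp.norm_rpow_eq_tsum (p := 2) (by norm_num) (coords β f)
  simp only [ENNReal.toReal_ofNat, Real.rpow_ofNat] at h
  rw [h0, h]
  refine tsum_congr fun n => ?_
  change ‖(Real.sqrt (β n) : ℂ) * taylorCoeff f n‖ ^ 2 = _
  rw [norm_mul, mul_pow, Complex.norm_real, Real.norm_eq_abs, sq_abs, Real.sq_sqrt (β.pos n).le,
    mul_comm]

end WeightedHardy

/-- A symbol: a non-constant analytic self-map of the unit disc. -/
structure IsSymbol (φ : 𝔻 → 𝔻) : Prop where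
  analytic : IsAnalyticOnDisc (fun z => (φ z : ℂ))
  nonconstant : ¬ ∃ c : 𝔻, ∀ z, φ z = c

/-- The continuous linear operator `T` on `H²(β)` is the composition operator `C_φ f = f ∘ φ`. -/
def IsCompositionOperator {β : Weight} (φ : 𝔻 → 𝔻)
    (T : WeightedHardy β →L[ℂ] WeightedHardy β) : Prop :=
  ∀ f : WeightedHardy β, (T f : 𝔻 → ℂ) = (f : 𝔻 → ℂ) ∘ φ

/-- `C_φ` is (well defined and) bounded on `H²(β)`. -/
def CompositionBounded (β : Weight) (φ : 𝔻 → 𝔻) : Prop :=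
  ∃ T : WeightedHardy β →L[ℂ] WeightedHardy β, IsCompositionOperator φ T

/-- `C_φ` is (well defined, bounded and) compact on `H²(β)`. -/
def CompositionCompact (β : Weight) (φ : 𝔻 → 𝔻) : Prop :=
  ∃ T : WeightedHardy β →L[ℂ] WeightedHardy β, IsCompositionOperator φ T ∧ IsCompactOperator T

theorem discAut_norm_lt_one (a z : 𝔻) :
    ‖((a : ℂ) + z) / (1 + conj (a : ℂ) * z)‖ < 1 := by
  have ha := a.sq_norm_lt_one
  have hz := z.sq_norm_lt_one
  have key : ‖1 + conj (a : ℂ) * z‖ ^ 2 - ‖(a : ℂ) + z‖ ^ 2 =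
      (1 - ‖(a : ℂ)‖ ^ 2) * (1 - ‖(z : ℂ)‖ ^ 2) := by
    simp only [← Complex.normSq_eq_norm_sq, Complex.normSq_apply]
    simp
    ring
  have hpos : 0 < (1 - ‖(a : ℂ)‖ ^ 2) * (1 - ‖(z : ℂ)‖ ^ 2) :=
    mul_pos (by linarith) (by linarith)
  have hlt : ‖(a : ℂ) + z‖ < ‖1 + conj (a : ℂ) * z‖ :=
    lt_of_pow_lt_pow_left₀ 2 (norm_nonneg _) (by linarith)
  rw [norm_div, div_lt_one ((norm_nonneg _).trans_lt hlt)]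
  exact hlt

/-- The automorphism `T_a(z) = (a + z) / (1 + ā z)` of the unit disc. -/
def discAut (a z : 𝔻) : 𝔻 :=
  Complex.UnitDisc.mk (((a : ℂ) + z) / (1 + conj (a : ℂ) * z)) (discAut_norm_lt_one a z)

/-- `H²(β)` is disc-automorphism invariant: every `C_{T_a}`, `a ∈ 𝔻`, is bounded. -/
def DiscAutomorphismInvariant (β : Weight) : Prop :=
  ∀ a : 𝔻, CompositionBounded β (discAut a)

/-- `p`, in the closed unit disc, is the Denjoy–Wolff point of `φ`: the iterates of `φ` converge
to `p` uniformly on the compact subsets of the open disc. -/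
def IsDenjoyWolffPoint (φ : 𝔻 → 𝔻) (p : ℂ) : Prop :=
  ‖p‖ ≤ 1 ∧ TendstoLocallyUniformly (fun (n : ℕ) (z : 𝔻) => ((φ^[n] z : 𝔻) : ℂ)) (fun _ => p) atTop

end

open Filter Topology
open scoped ENNReal Complex.UnitDisc ComplexConjugate

noncomputable section

/-! ### Analytic functions on the disc -/

/-! Everything reduces to a fixed point p of φ inside 𝔻. Conjugating by `discAut p` moves p to 0,
and the conjugate ψ still has a compact C_ψ. So ψ is not a rotation, since otherwise the identity of
an infinite-dimensional space would be compact. Hence the Schwarz inequality is strict off 0 and the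
iterates of ψ tend to 0.

For the fixed point, take r_k → 1 with 0 ≤ r_k < 1, solve p_k = r_k φ(p_k), and let ζ be a limit of
a subsequence. Along it φ(p_k) → ζ too, so an interior ζ is fixed. Compactness excludes |ζ| = 1, in
two cases.

If ∑ 1/β_n diverges, the norm of evaluation at z blows up as |z| → 1. Normalised kernels at φ(p_k)
have images under C_φ whose values at p_k are at least that norm, because |p_k| ≤ |φ(p_k)|. A
convergent subsequence of images cannot grow this fast, polynomials being dense and bounded
(`CompositionCompact.false_of_not_summable`).

If ∑ 1/β_n converges, evaluations are uniformly bounded and elements of H²(β) behave continuously up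
to the circle. After an automorphism and a rotation, ψ(0) = 0 and ψ(p_k) → ζ. Riesz theory solves
f∘ψ − f = z (`CompositionCompact.exists_comp_sub_eq`). Along p_k the left side tends to 0 and the
right side to ζ ≠ 0 (`CompositionCompact.false_of_summable`). -/

theorem isAnalyticOnDisc_of_eq {f : 𝔻 → ℂ} {F : ℂ → ℂ}
    (hF : DifferentiableOn ℂ F (Metric.ball 0 1)) (h : ∀ z : 𝔻, f z = F z) :
    IsAnalyticOnDisc f := by
  refine hF.congr fun z hz => ?_
  rw [mem_ball_zero_iff] at hz
  exact (discExt_coe f (Complex.UnitDisc.mk z hz)).trans (h _)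

theorem IsAnalyticOnDisc.comp {g : 𝔻 → ℂ} {φ : 𝔻 → 𝔻} (hg : IsAnalyticOnDisc g)
    (hφ : IsAnalyticOnDisc fun z => (φ z : ℂ)) : IsAnalyticOnDisc fun z => g (φ z) := by
  refine isAnalyticOnDisc_of_eq (F := discExt g ∘ discExt fun z => (φ z : ℂ)) ?_ fun z => ?_
  · refine DifferentiableOn.comp hg hφ fun z hz => ?_
    rw [mem_ball_zero_iff] at hz ⊢
    have h := discExt_coe (fun z => (φ z : ℂ)) (Complex.UnitDisc.mk z hz)
    rw [Complex.UnitDisc.coe_mk] at h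
    rw [h]
    exact Complex.UnitDisc.norm_lt_one _
  · simp [discExt_coe]

theorem IsAnalyticOnDisc.continuous {f : 𝔻 → ℂ} (hf : IsAnalyticOnDisc f) : Continuous f := by
  have h : Continuous fun z : 𝔻 => discExt f z :=
    hf.continuousOn.comp_continuous Complex.UnitDisc.continuous_coe fun z => by
      simpa using z.norm_lt_one
  simpa only [discExt_coe] using h

theorem continuous_of_isAnalyticOnDisc_coe {φ : 𝔻 → 𝔻}
    (hφ : IsAnalyticOnDisc fun z => (φ z : ℂ)) : Continuous φ :=
  Complex.UnitDisc.isEmbedding_coe.continuous_iff.2 hφ.continuous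

/-! ### Disc automorphisms -/

theorem coe_discAut (a z : 𝔻) :
    (discAut a z : ℂ) = ((a : ℂ) + z) / (1 + conj (a : ℂ) * z) := rfl

theorem one_add_conj_mul_ne_zero (a : 𝔻) {z : ℂ} (hz : ‖z‖ ≤ 1) : 1 + conj (a : ℂ) * z ≠ 0 := by
  intro h
  have h1 : ‖conj (a : ℂ) * z‖ = 1 := by
    rw [eq_neg_of_add_eq_zero_right h, norm_neg, norm_one]
  rw [norm_mul, RCLike.norm_conj] at h1
  nlinarith [a.norm_lt_one, norm_nonneg (a : ℂ), norm_nonneg z]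

theorem isAnalyticOnDisc_discAut (a : 𝔻) : IsAnalyticOnDisc fun z => (discAut a z : ℂ) := by
  refine isAnalyticOnDisc_of_eq (F := fun z => ((a : ℂ) + z) / (1 + conj (a : ℂ) * z)) ?_
    fun z => rfl
  refine DifferentiableOn.div (by fun_prop) (by fun_prop) fun z hz => ?_
  exact one_add_conj_mul_ne_zero a (mem_ball_zero_iff.1 hz).le

theorem continuous_discAut (a : 𝔻) : Continuous (discAut a) :=
  continuous_of_isAnalyticOnDisc_coe (isAnalyticOnDisc_discAut a)

theorem discAut_neg_discAut (a z : 𝔻) : discAut (-a) (discAut a z) = z := by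
  have h1 := one_add_conj_mul_ne_zero a z.norm_lt_one.le
  have h2 := one_add_conj_mul_ne_zero (-a) (discAut a z).norm_lt_one.le
  rw [← Complex.UnitDisc.coe_inj, coe_discAut, div_eq_iff h2, coe_discAut]
  simp only [Complex.UnitDisc.coe_neg, map_neg]
  generalize conj (a : ℂ) = b at h1
  rw [neg_mul, ← sub_eq_add_neg, mul_sub, mul_one]
  rw [mul_comm (z : ℂ), mul_assoc, div_mul_eq_mul_div, ← mul_div_assoc, eq_sub_iff_add_eq,
    add_assoc, ← add_div, neg_add_eq_iff_eq_add, div_eq_iff h1]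
  ring

theorem discAut_discAut_neg (a z : 𝔻) : discAut a (discAut (-a) z) = z := by
  simpa using discAut_neg_discAut (-a) z

theorem discAut_apply_zero (a : 𝔻) : discAut a 0 = a := by
  simp [← Complex.UnitDisc.coe_inj, coe_discAut]

theorem discAut_neg_apply_self (a : 𝔻) : discAut (-a) a = 0 := by
  simp [← Complex.UnitDisc.coe_inj, coe_discAut]

/-! ### The Schwarz and Schwarz–Pick lemmas -/

section Schwarz

variable {ψ : 𝔻 → 𝔻}

theorem mapsTo_discExt_coe (ψ : 𝔻 → 𝔻) :
    Set.MapsTo (discExt fun z => (ψ z : ℂ)) (Metric.ball 0 1) (Metric.closedBall 0 1) := by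
  intro z hz
  rw [mem_ball_zero_iff] at hz
  rw [mem_closedBall_zero_iff]
  have h := discExt_coe (fun z => (ψ z : ℂ)) (Complex.UnitDisc.mk z hz)
  rw [Complex.UnitDisc.coe_mk] at h
  rw [h]
  exact (Complex.UnitDisc.norm_lt_one _).le

theorem schwarz_norm_le (hψ : IsAnalyticOnDisc fun z => (ψ z : ℂ)) (h0 : ψ 0 = 0)
    (z : 𝔻) : ‖(ψ z : ℂ)‖ ≤ ‖(z : ℂ)‖ := by
  have h := Complex.norm_le_norm_of_mapsTo_ball hψ (mapsTo_discExt_coe ψ)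
    (by simpa [h0] using discExt_coe (fun z => (ψ z : ℂ)) 0) z.norm_lt_one
  rwa [discExt_coe] at h

theorem schwarz_rotation (hψ : IsAnalyticOnDisc fun z => (ψ z : ℂ)) (h0 : ψ 0 = 0)
    {z : 𝔻} (hz : z ≠ 0) (h : ‖(ψ z : ℂ)‖ = ‖(z : ℂ)‖) :
    ∃ c : Circle, ∀ w, ψ w = c • w := by
  have hz' : (z : ℂ) ≠ 0 := by simpa using hz
  have h0' : discExt (fun z => (ψ z : ℂ)) 0 = 0 := by
    simpa [h0] using discExt_coe (fun z => (ψ z : ℂ)) 0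
  obtain ⟨C, hC, hE⟩ := Complex.affine_of_mapsTo_ball_of_exists_norm_dslope_eq_div' hψ
    (by simpa only [h0'] using mapsTo_discExt_coe ψ)
    ⟨z, by simpa using z.norm_lt_one, by
      rw [dslope_of_ne _ hz', slope_def_module, h0', discExt_coe]
      simp [h, hz']⟩
  obtain ⟨c, rfl⟩ : ∃ c : Circle, (c : ℂ) = C :=
    ⟨⟨C, mem_sphere_zero_iff_norm.2 (by simpa using hC)⟩, rfl⟩
  refine ⟨c, fun w => ?_⟩
  have hw := hE (show (w : ℂ) ∈ Metric.ball 0 1 by simpa using w.norm_lt_one)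
  rw [discExt_coe, h0'] at hw
  rw [← Complex.UnitDisc.coe_inj, Complex.UnitDisc.coe_circle_smul, hw]
  change 0 + ((w : ℂ) - 0) • (c : ℂ) = c * w
  simp [mul_comm]

theorem schwarz_pick (hψ : IsAnalyticOnDisc fun z => (ψ z : ℂ)) (z w : 𝔻) :
    ‖(discAut (-ψ w) (ψ z) : ℂ)‖ ≤ ‖(discAut (-w) z : ℂ)‖ := by
  have h := schwarz_norm_le (ψ := fun u => discAut (-ψ w) (ψ (discAut w u)))
    ((isAnalyticOnDisc_discAut (-ψ w)).comp
      (φ := fun u => ψ (discAut w u)) (hψ.comp (isAnalyticOnDisc_discAut w)))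
    (by simp only [discAut_apply_zero, discAut_neg_apply_self]) (discAut (-w) z)
  simpa only [discAut_discAut_neg] using h

end Schwarz

theorem norm_discAut_neg (z w : 𝔻) :
    ‖(discAut (-w) z : ℂ)‖ = ‖(z : ℂ) - w‖ / ‖1 - conj (w : ℂ) * z‖ := by
  rw [coe_discAut, norm_div]
  simp [sub_eq_add_neg, add_comm]

/-- Scaling by a real r strictly shrinks the pseudohyperbolic distance, by the identity |1 − r²w̄z|²
− r²|1 − w̄z|² = (1 − r²)(1 − r²|w|²|z|²). -/
theorem norm_discAut_neg_mul_lt {r z w : 𝔻} (hr : conj (r : ℂ) = r) (hzw : z ≠ w) :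
    ‖(discAut (-(r * w)) (r * z) : ℂ)‖ < ‖(discAut (-w) z : ℂ)‖ := by
  have hd : (z : ℂ) - w ≠ 0 := by rwa [sub_ne_zero, Ne, Complex.UnitDisc.coe_inj]
  have h1 : 1 - conj (w : ℂ) * z ≠ 0 := by
    simpa [sub_eq_add_neg] using one_add_conj_mul_ne_zero (-w) z.norm_lt_one.le
  have h2 : 1 - conj (w : ℂ) * (r ^ 2 * z) ≠ 0 := by
    have := one_add_conj_mul_ne_zero (-(r * w)) (r * z).norm_lt_one.le
    simp only [Complex.UnitDisc.coe_neg, Complex.UnitDisc.coe_mul, map_neg, map_mul, hr] at this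
    convert this using 1; ring
  have key : ‖1 - conj (w : ℂ) * (r ^ 2 * z)‖ ^ 2 - (‖(r : ℂ)‖ * ‖1 - conj (w : ℂ) * z‖) ^ 2
      = (1 - ‖(r : ℂ)‖ ^ 2) * (1 - ‖(r * w : ℂ)‖ ^ 2 * ‖(z : ℂ)‖ ^ 2) := by
    have him : (r : ℂ).im = 0 := Complex.conj_eq_iff_im.1 hr
    simp only [mul_pow, ← Complex.normSq_eq_norm_sq, Complex.normSq_apply, sq (r : ℂ)]
    simp only [Complex.sub_re, Complex.sub_im, Complex.mul_re, Complex.mul_im, Complex.one_re,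
      Complex.one_im, Complex.conj_re, Complex.conj_im, him]
    ring
  have hpos : 0 < (1 - ‖(r : ℂ)‖ ^ 2) * (1 - ‖(r * w : ℂ)‖ ^ 2 * ‖(z : ℂ)‖ ^ 2) := by
    have h3 := (r * w).sq_norm_lt_one
    rw [Complex.UnitDisc.coe_mul] at h3
    have h4 := z.sq_norm_lt_one
    have h5 := r.sq_norm_lt_one
    refine mul_pos (by linarith) ?_
    nlinarith [sq_nonneg ‖(r * w : ℂ)‖, sq_nonneg ‖(z : ℂ)‖]
  have hlt : ‖(r : ℂ)‖ * ‖1 - conj (w : ℂ) * z‖ < ‖1 - conj (w : ℂ) * (r ^ 2 * z)‖ :=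
    lt_of_pow_lt_pow_left₀ 2 (norm_nonneg _) (by linarith)
  rw [norm_discAut_neg, norm_discAut_neg]
  have e1 : ((r * z : 𝔻) : ℂ) - (r * w : 𝔻) = r * (z - w) := by
    simp only [Complex.UnitDisc.coe_mul]; ring
  have e2 : 1 - conj ((r * w : 𝔻) : ℂ) * (r * z : 𝔻) = 1 - conj (w : ℂ) * (r ^ 2 * z) := by
    simp only [Complex.UnitDisc.coe_mul, map_mul, hr]; ring
  rw [e1, e2, norm_mul, div_lt_div_iff₀ (norm_pos_iff.2 h2) (norm_pos_iff.2 h1)]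
  have := mul_lt_mul_of_pos_left hlt (norm_pos_iff.2 hd)
  linarith

/-! ### Fixed points of contracted self-maps -/

theorem isCompact_norm_coe_le {r : ℝ} (hr : r < 1) : IsCompact {z : 𝔻 | ‖(z : ℂ)‖ ≤ r} := by
  rw [Complex.UnitDisc.isEmbedding_coe.isCompact_iff]
  convert isCompact_closedBall (0 : ℂ) r
  ext z
  simp only [Set.mem_image, Set.mem_ofPred_eq, mem_closedBall_zero_iff]
  constructor
  · rintro ⟨w, hw, rfl⟩
    exact hw
  · intro hz
    exact ⟨Complex.UnitDisc.mk z (hz.trans_lt hr), by simpa using hz, by simp⟩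

/-- On the compact disc |z| ≤ |r|, which rφ maps into itself, the pseudohyperbolic distance from z
to rφ(z) attains its minimum at some p. If p were not fixed, passing to rφ(p) would give a smaller
value, by Schwarz–Pick and the strict contraction. -/
theorem exists_mul_apply_eq_self {φ : 𝔻 → 𝔻} (hφ : IsAnalyticOnDisc fun z => (φ z : ℂ))
    {r : 𝔻} (hr : conj (r : ℂ) = r) : ∃ p : 𝔻, r * φ p = p := by
  have hcont := continuous_of_isAnalyticOnDisc_coe hφ
  have hle : ∀ z : 𝔻, ‖((r * z : 𝔻) : ℂ)‖ ≤ ‖(r : ℂ)‖ := fun z => by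
    rw [Complex.UnitDisc.coe_mul, norm_mul]
    exact mul_le_of_le_one_right (norm_nonneg _) z.norm_lt_one.le
  have hc : Continuous fun z : 𝔻 => ‖(discAut (-(r * φ z)) z : ℂ)‖ := by
    have hcφ : Continuous fun z => (φ z : ℂ) := hφ.continuous
    have hcz := Complex.UnitDisc.continuous_coe
    simp only [norm_discAut_neg, Complex.UnitDisc.coe_mul]
    refine Continuous.div (by fun_prop) ?_ fun z => ?_
    · exact (continuous_const.sub ((Complex.continuous_conj.comp
        (continuous_const.mul hcφ)).mul hcz)).norm
    · rw [norm_ne_zero_iff]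
      simpa [sub_eq_add_neg] using one_add_conj_mul_ne_zero (-(r * φ z)) z.norm_lt_one.le
  obtain ⟨p, -, hp⟩ := (isCompact_norm_coe_le r.norm_lt_one).exists_isMinOn
    ⟨r * 0, hle 0⟩ hc.continuousOn
  refine ⟨p, ?_⟩
  by_contra hne
  have h1 := hp (hle (φ p))
  simp only [Set.mem_ofPred_eq] at h1
  -- Strict contraction needs distinct points. If φ agrees at p and rφ(p), then rφ(p) is itself
  -- fixed, so the minimum is 0.
  rcases ne_or_eq (φ (r * φ p)) (φ p) with h2 | h2
  · have h3 := norm_discAut_neg_mul_lt hr h2.symm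
    have h4 := schwarz_pick hφ p (r * φ p)
    have h5 : ‖(discAut (-(r * φ p)) p : ℂ)‖ = ‖(discAut (-p) (r * φ p) : ℂ)‖ := by
      rw [norm_discAut_neg, norm_discAut_neg, norm_sub_rev]
      congr 1
      rw [← RCLike.norm_conj]
      simp [mul_comm]
    linarith
  · rw [h2, discAut_neg_apply_self] at h1
    have h3 : discAut (-(r * φ p)) p = 0 := by simpa using h1
    refine hne ?_
    have := discAut_discAut_neg (r * φ p) p
    rwa [h3, discAut_apply_zero] at this

/-! ### Iterates of a self-map fixing the origin -/

/-- The moduli decrease to a limit l, and a cluster point w of the orbit satisfies |w| = |ψ(w)| = l,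
which forces w = 0. -/
theorem tendsto_iterate_zero {ψ : 𝔻 → 𝔻} (hc : Continuous ψ)
    (hlt : ∀ z : 𝔻, z ≠ 0 → ‖(ψ z : ℂ)‖ < ‖(z : ℂ)‖) (h0 : ψ 0 = 0) (z : 𝔻) :
    Tendsto (fun n => ‖(ψ^[n] z : ℂ)‖) atTop (𝓝 0) := by
  have hle : ∀ w : 𝔻, ‖(ψ w : ℂ)‖ ≤ ‖(w : ℂ)‖ := fun w => by
    rcases eq_or_ne w 0 with rfl | hw
    · rw [h0]
    · exact (hlt w hw).le
  have hanti : Antitone fun n => ‖(ψ^[n] z : ℂ)‖ := antitone_nat_of_succ_le fun n => by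
    rw [Function.iterate_succ_apply']
    exact hle _
  have hlim := tendsto_atTop_ciInf hanti ⟨0, by rintro _ ⟨n, rfl⟩; exact norm_nonneg _⟩
  set l := ⨅ n, ‖(ψ^[n] z : ℂ)‖
  have := Complex.UnitDisc.isEmbedding_coe.isInducing.firstCountableTopology
  obtain ⟨w, -, θ, hθ, hw⟩ := (isCompact_norm_coe_le z.norm_lt_one).tendsto_subseq
    (x := fun n => ψ^[n] z) fun n => hanti (Nat.zero_le n)
  have hn : Continuous fun z : 𝔻 => ‖(z : ℂ)‖ := Complex.UnitDisc.continuous_coe.norm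
  have h1 : ‖(w : ℂ)‖ = l :=
    tendsto_nhds_unique ((hn.tendsto w).comp hw) (hlim.comp hθ.tendsto_atTop)
  have h2 : ‖(ψ w : ℂ)‖ = l := by
    refine tendsto_nhds_unique (((hn.comp hc).tendsto w).comp hw)
      (((tendsto_add_atTop_iff_nat 1).2 hlim).comp hθ.tendsto_atTop |>.congr fun n => ?_)
    simp [Function.iterate_succ_apply']
  have hw0 : w = 0 := by
    by_contra hw0
    exact absurd (hlt w hw0) (by rw [h1, h2]; exact lt_irrefl _)
  rw [hw0] at h1
  simpa [← h1] using hlim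

/-- Dini's theorem applies, the moduli being continuous and decreasing in n. -/
theorem tendstoLocallyUniformly_iterate_zero {ψ : 𝔻 → 𝔻} (hc : Continuous ψ)
    (hlt : ∀ z : 𝔻, z ≠ 0 → ‖(ψ z : ℂ)‖ < ‖(z : ℂ)‖) (h0 : ψ 0 = 0) :
    TendstoLocallyUniformly (fun (n : ℕ) (z : 𝔻) => ((ψ^[n] z : 𝔻) : ℂ)) (fun _ => 0) atTop := by
  have hle : ∀ w : 𝔻, ‖(ψ w : ℂ)‖ ≤ ‖(w : ℂ)‖ := fun w => by
    rcases eq_or_ne w 0 with rfl | hw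
    · rw [h0]
    · exact (hlt w hw).le
  have hn : Continuous fun z : 𝔻 => ‖(z : ℂ)‖ := Complex.UnitDisc.continuous_coe.norm
  have h := Antitone.tendstoLocallyUniformly_of_forall_tendsto
    (F := fun n z => ‖(ψ^[n] z : ℂ)‖) (f := fun _ => 0) (fun n => hn.comp (hc.iterate n))
    (antitone_nat_of_succ_le fun n z => by
      rw [Function.iterate_succ_apply']
      exact hle _) continuous_const (tendsto_iterate_zero hc hlt h0)
  rw [Metric.tendstoLocallyUniformly_iff] at h ⊢
  intro ε hε x
  obtain ⟨t, ht, h⟩ := h ε hε x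
  refine ⟨t, ht, h.mono fun n hn y hy => ?_⟩
  have := hn y hy
  simpa [dist_eq_norm] using this

theorem tendstoLocallyUniformly_iterate_conj {φ : 𝔻 → 𝔻} {p : 𝔻}
    (h : TendstoLocallyUniformly
      (fun (n : ℕ) (z : 𝔻) => (((fun u => discAut (-p) (φ (discAut p u)))^[n] z : 𝔻) : ℂ))
      (fun _ => 0) atTop) :
    TendstoLocallyUniformly (fun (n : ℕ) (z : 𝔻) => ((φ^[n] z : 𝔻) : ℂ)) (fun _ => (p : ℂ))
      atTop := by
  have hsemi : ∀ n z, discAut p ((fun u => discAut (-p) (φ (discAut p u)))^[n] z) =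
      φ^[n] (discAut p z) := fun n z =>
    Function.Semiconj.iterate_right (f := discAut p)
      (fun u => discAut_discAut_neg p (φ (discAut p u))) n z
  have h1 := h.comp (discAut (-p)) (continuous_discAut (-p))
  -- As the limit is constant, local uniformity is convergence along `atTop ×ˢ 𝓝 x`. Continuity of
  -- `discAut p` at the single point 0 then suffices.
  rw [tendstoLocallyUniformly_iff_forall_tendsto] at h1 ⊢
  intro x
  have h2 := h1 x
  simp only [Function.comp_apply] at h2
  change Tendsto (Prod.mk (0 : ℂ) ∘ _) _ _ at h2
  rw [← tendsto_comap_iff (g := Prod.mk (0 : ℂ)), ← nhds_eq_comap_uniformity] at h2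
  rw [← Complex.UnitDisc.coe_zero] at h2
  replace h2 := Complex.UnitDisc.isEmbedding_coe.tendsto_nhds_iff.2 h2
  have hcont : Continuous fun z => (discAut p z : ℂ) := (isAnalyticOnDisc_discAut p).continuous
  have h3 := (hcont.tendsto 0).comp h2
  rw [discAut_apply_zero, nhds_eq_comap_uniformity, tendsto_comap_iff] at h3
  refine h3.congr fun q => ?_
  simp only [Function.comp_apply, hsemi, discAut_discAut_neg]

/-! ### Functions with prescribed Taylor coefficients -/

section PowerSeries

variable {a : ℕ → ℂ} {f : 𝔻 → ℂ}

theorem hasFPowerSeriesOnBall_discExt (h : ∀ z : 𝔻, HasSum (fun n => a n * (z : ℂ) ^ n) (f z)) :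
    HasFPowerSeriesOnBall (discExt f) (FormalMultilinearSeries.ofScalars ℂ a) 0 1 where
  r_le := by
    refine ENNReal.le_of_forall_nnreal_lt fun r hr => ?_
    have hr' : ‖((r : ℝ) : ℂ)‖ < 1 := by
      simpa using hr
    refine FormalMultilinearSeries.le_radius_of_tendsto _ (l := 0) ?_
    have h1 := (h (Complex.UnitDisc.mk _ hr')).summable.tendsto_atTop_zero.norm
    simpa using h1
  r_pos := one_pos
  hasSum := by
    intro y hy
    have hy' : ‖y‖ < 1 := by
      rwa [← ENNReal.ofReal_one, Metric.eball_ofReal, mem_ball_zero_iff] at hy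
    have h1 := h (Complex.UnitDisc.mk y hy')
    rw [← discExt_coe f] at h1
    simpa [FormalMultilinearSeries.ofScalars_apply_eq, mul_comm] using h1

theorem isAnalyticOnDisc_of_hasSum (h : ∀ z : 𝔻, HasSum (fun n => a n * (z : ℂ) ^ n) (f z)) :
    IsAnalyticOnDisc f := by
  have := (hasFPowerSeriesOnBall_discExt h).differentiableOn
  rwa [← ENNReal.ofReal_one, Metric.eball_ofReal] at this

theorem taylorCoeff_eq_of_hasSum (h : ∀ z : 𝔻, HasSum (fun n => a n * (z : ℂ) ^ n) (f z)) (n : ℕ) :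
    taylorCoeff f n = a n := by
  have h1 := (hasFPowerSeriesOnBall_discExt h).factorial_smul 1 n
  rw [taylorCoeff, iteratedDeriv_eq_iteratedFDeriv, ← h1]
  have : (n.factorial : ℂ) ≠ 0 := by exact_mod_cast n.factorial_ne_zero
  simp [this]

end PowerSeries

/-! ### Evaluation functionals, kernels and completeness of H²(β). -/

theorem Weight.summable_norm_pow_div (β : Weight) (z : 𝔻) :
    Summable fun n => ‖(z : ℂ)‖ ^ (2 * n) / β n := by
  have hz := z.sq_norm_lt_one
  -- With |z|² < ρ < 1, eventually β_n ≥ ρⁿ, which gives a geometric majorant of ratio |z|²/ρ.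
  obtain ⟨ρ, h1, h2⟩ := exists_between hz
  have hρ : 0 < ρ := (sq_nonneg _).trans_lt h1
  have hlt : ENNReal.ofReal ρ <
      liminf (fun n : ℕ => ENNReal.ofReal (β n ^ (1 / (n : ℝ)))) atTop :=
    lt_of_lt_of_le (by simpa using h2) β.one_le_liminf
  have hev := eventually_lt_of_lt_liminf hlt
  have hgeo : Summable fun n => (‖(z : ℂ)‖ ^ 2 / ρ) ^ n :=
    summable_geometric_of_lt_one (by positivity) ((div_lt_one hρ).2 h1)
  refine Summable.of_norm_bounded_eventually_nat hgeo ?_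
  filter_upwards [hev, eventually_gt_atTop 0] with n hn hn0
  have h3 : ρ < β n ^ (1 / (n : ℝ)) := (ENNReal.ofReal_lt_ofReal_iff_of_nonneg hρ.le).1 hn
  have h4 : ρ ^ n ≤ β n := by
    calc ρ ^ n ≤ (β n ^ (1 / (n : ℝ))) ^ n := pow_le_pow_left₀ hρ.le h3.le n
      _ = β n := by
        rw [one_div, Real.rpow_inv_natCast_pow (β.pos n).le hn0.ne']
  rw [Real.norm_of_nonneg (div_nonneg (by positivity) (β.pos n).le), pow_mul, div_pow]
  exact div_le_div_of_nonneg_left (by positivity) (by positivity) h4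

/-- The square of the norm of the evaluation functional at `z`. -/
def kernelDiag (β : Weight) (z : 𝔻) : ℝ := ∑' n, ‖(z : ℂ)‖ ^ (2 * n) / β n

namespace WeightedHardy

variable {β : Weight}

theorem exists_taylorCoeff_eq {a : ℕ → ℂ} (ha : Summable fun n => ‖a n‖ ^ 2 * β n) :
    ∃ f : WeightedHardy β, ∀ n, taylorCoeff f n = a n := by
  have hs : ∀ z : 𝔻, Summable fun n => a n * (z : ℂ) ^ n := fun z => by
    refine Summable.of_norm_bounded (ha.add (β.summable_norm_pow_div z)) fun n => ?_
    have hβ := β.pos n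
    rw [norm_mul, norm_pow, pow_mul', ← sub_nonneg]
    set x := ‖a n‖
    set y := ‖(z : ℂ)‖ ^ n
    have : x ^ 2 * β n + y ^ 2 / β n - x * y =
        ((x * β n - y / 2) ^ 2 + 3 / 4 * y ^ 2) / β n := by
      field_simp
      ring
    rw [this]
    positivity
  have hf : ∀ z : 𝔻, HasSum (fun n => a n * (z : ℂ) ^ n) ((fun z : 𝔻 => ∑' n, a n * (z : ℂ) ^ n) z) :=
    fun z => (hs z).hasSum
  have hc := taylorCoeff_eq_of_hasSum hf
  exact ⟨⟨_, isAnalyticOnDisc_of_hasSum hf, by simpa only [hc] using ha⟩, hc⟩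

/-- The coordinates form an isometry onto ℓ². Completeness is what Riesz theory and the inversion of
bijective operators require. -/
instance : CompleteSpace (WeightedHardy β) := by
  have hsurj : Function.Surjective (coords β) := by
    intro x
    have hne : ∀ n, (Real.sqrt (β n) : ℂ) ≠ 0 := fun n => by
      exact_mod_cast (Real.sqrt_pos.2 (β.pos n)).ne'
    obtain ⟨f, hf⟩ := exists_taylorCoeff_eq (β := β)
      (a := fun n => (Real.sqrt (β n) : ℂ)⁻¹ * x n) (by
        rw [← memlp_coeff_iff]
        simpa only [mul_inv_cancel_left₀ (hne _)] using lp.memℓp x)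
    refine ⟨f, lp.ext (funext fun n => ?_)⟩
    change (Real.sqrt (β n) : ℂ) * taylorCoeff f n = x n
    rw [hf, mul_inv_cancel_left₀ (hne n)]
  have hiso : Isometry (coords β) :=
    AddMonoidHomClass.isometry_of_norm (coords β) fun _ => rfl
  exact (IsometryEquiv.mk (Equiv.ofBijective _ ⟨coords_injective β, hsurj⟩) hiso).completeSpace

theorem hasSum_coeff (f : WeightedHardy β) (z : 𝔻) :
    HasSum (fun n => taylorCoeff f n * (z : ℂ) ^ n) (f z) :=
  hasSum_taylorCoeff f.2.1 z

theorem sub_apply (f g : WeightedHardy β) (z : 𝔻) : (f - g) z = f z - g z := rfl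

theorem neg_apply (f : WeightedHardy β) (z : 𝔻) : (-f) z = -f z := rfl

theorem smul_apply (c : ℂ) (f : WeightedHardy β) (z : 𝔻) : (c • f) z = c * f z := rfl

theorem ext_apply {f g : WeightedHardy β} (h : ∀ z, f z = g z) : f = g :=
  Subtype.ext (funext h)

theorem kernelDiag_pos (z : 𝔻) : 0 < kernelDiag β z :=
  (β.summable_norm_pow_div z).tsum_pos
    (fun n => div_nonneg (by positivity) (β.pos n).le) 0 (by simpa using β.pos 0)

theorem norm_apply_le (f : WeightedHardy β) (z : 𝔻) : ‖f z‖ ≤ ‖f‖ * √(kernelDiag β z) := by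
  have hn : ∀ n, ‖(z : ℂ)‖ ^ (2 * n) / β n = (‖(z : ℂ)‖ ^ n / √(β n)) ^ (2 : ℝ) := fun n => by
    rw [Real.rpow_two, div_pow, Real.sq_sqrt (β.pos n).le, pow_mul']
  have hm : ∀ n, ‖taylorCoeff f n‖ ^ 2 * β n = (‖taylorCoeff f n‖ * √(β n)) ^ (2 : ℝ) := fun n => by
    rw [Real.rpow_two, mul_pow, Real.sq_sqrt (β.pos n).le]
  have hs1 := f.2.2
  have hs2 := β.summable_norm_pow_div z
  simp only [hn] at hs2
  change Summable fun n => ‖taylorCoeff f n‖ ^ 2 * β n at hs1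
  simp only [hm] at hs1
  have h := Real.summable_and_inner_le_Lp_mul_Lq_tsum_of_nonneg
    (f := fun n => ‖taylorCoeff f n‖ * √(β n)) (g := fun n => ‖(z : ℂ)‖ ^ n / √(β n))
    Real.HolderConjugate.two_two (fun n => by positivity) (fun n => by positivity) hs1 hs2
  have hterm : ∀ n, ‖taylorCoeff f n‖ * √(β n) * (‖(z : ℂ)‖ ^ n / √(β n)) =
      ‖taylorCoeff f n * (z : ℂ) ^ n‖ := fun n => by
    have := (Real.sqrt_pos.2 (β.pos n)).ne'
    rw [norm_mul, norm_pow]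
    field_simp
  simp only [hterm, ← hn, ← hm, ← norm_sq_eq, ← Real.sqrt_eq_rpow,
    Real.sqrt_sq (norm_nonneg _)] at h
  calc ‖f z‖ = ‖∑' n, taylorCoeff f n * (z : ℂ) ^ n‖ := by rw [(hasSum_coeff f z).tsum_eq]
    _ ≤ _ := norm_tsum_le_tsum_norm h.1
    _ ≤ _ := h.2

/-- The evaluation functional at a point of the disc. -/
def eval (z : 𝔻) : WeightedHardy β →L[ℂ] ℂ :=
  LinearMap.mkContinuous
    { toFun := fun f => f z
      map_add' := fun _ _ => rfl
      map_smul' := fun _ _ => rfl } (√(kernelDiag β z)) fun f => by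
    rw [mul_comm]
    exact norm_apply_le f z

theorem eval_apply (z : 𝔻) (f : WeightedHardy β) : eval z f = f z := rfl

/-- The witness is the normalised reproducing kernel at w, with coefficients w̄ⁿ/β_n before
normalisation. It attains the bound of `norm_apply_le`. -/
theorem exists_norm_le_one_apply_eq (w : 𝔻) :
    ∃ f : WeightedHardy β, ‖f‖ ≤ 1 ∧ f w = (√(kernelDiag β w) : ℂ) := by
  have hterm : ∀ n, ‖conj (w : ℂ) ^ n / (β n : ℂ)‖ ^ 2 * β n = ‖(w : ℂ)‖ ^ (2 * n) / β n := by
    intro n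
    have := (β.pos n).ne'
    rw [norm_div, norm_pow, RCLike.norm_conj, Complex.norm_of_nonneg (β.pos n).le, pow_mul']
    field_simp
  obtain ⟨k, hk⟩ := exists_taylorCoeff_eq (β := β) (a := fun n => conj (w : ℂ) ^ n / (β n : ℂ))
    (by simpa only [hterm] using β.summable_norm_pow_div w)
  have hpos := kernelDiag_pos (β := β) w
  have hnorm : ‖k‖ = √(kernelDiag β w) := by
    rw [eq_comm, Real.sqrt_eq_iff_eq_sq hpos.le (norm_nonneg _), norm_sq_eq]
    simp only [hk, hterm, kernelDiag]
  have hval : k w = (kernelDiag β w : ℂ) := by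
    refine (hasSum_coeff k w).unique ?_
    have h1 := Complex.hasSum_ofReal.2 (β.summable_norm_pow_div w).hasSum
    refine h1.congr_fun fun n => ?_
    rw [hk, div_mul_eq_mul_div, ← mul_pow, mul_comm (conj _), Complex.mul_conj,
      Complex.normSq_eq_norm_sq]
    push_cast
    rw [pow_mul]
  have hs : √(kernelDiag β w) ≠ 0 := (Real.sqrt_pos.2 hpos).ne'
  refine ⟨((√(kernelDiag β w) : ℝ) : ℂ)⁻¹ • k, ?_, ?_⟩
  · rw [norm_smul, hnorm, norm_inv, Complex.norm_of_nonneg (Real.sqrt_nonneg _), inv_mul_cancel₀ hs]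
  · rw [smul_apply, hval, ← Complex.ofReal_inv, ← Complex.ofReal_mul]
    congr 1
    rw [inv_mul_eq_iff_eq_mul₀ hs, Real.mul_self_sqrt hpos.le]

/-! ### Polynomials -/

theorem hasSum_polynomial (P : Polynomial ℂ) (z : 𝔻) :
    HasSum (fun n => P.coeff n * (z : ℂ) ^ n) (P.eval (z : ℂ)) := by
  rw [Polynomial.eval_eq_sum, Polynomial.sum]
  exact hasSum_sum_of_ne_finset_zero fun n hn => by
    simp [Polynomial.notMem_support_iff.1 hn]

/-- Polynomials, as elements of `H²(β)`. -/
def ofPolynomial (β : Weight) : Polynomial ℂ →ₗ[ℂ] WeightedHardy β where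
  toFun P := ⟨fun z => P.eval (z : ℂ), isAnalyticOnDisc_of_hasSum (hasSum_polynomial P), by
    simp only [taylorCoeff_eq_of_hasSum (hasSum_polynomial P)]
    exact summable_of_ne_finset_zero (s := P.support) fun n hn => by
      simp [Polynomial.notMem_support_iff.1 hn]⟩
  map_add' P Q := ext_apply fun z => Polynomial.eval_add
  map_smul' c P := ext_apply fun z => Polynomial.eval_smul c P (z : ℂ)

theorem ofPolynomial_apply (P : Polynomial ℂ) (z : 𝔻) : ofPolynomial β P z = P.eval (z : ℂ) := rfl

theorem taylorCoeff_ofPolynomial (P : Polynomial ℂ) (n : ℕ) :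
    taylorCoeff (ofPolynomial β P) n = P.coeff n :=
  taylorCoeff_eq_of_hasSum (hasSum_polynomial P) n

theorem ofPolynomial_injective : Function.Injective (ofPolynomial β) := fun P Q h =>
  Polynomial.ext fun n => by
    rw [← taylorCoeff_ofPolynomial (β := β), h, taylorCoeff_ofPolynomial]

theorem not_finiteDimensional : ¬ FiniteDimensional ℂ (WeightedHardy β) := fun _ =>
  Polynomial.not_finite (R := ℂ) (Module.Finite.of_injective (ofPolynomial β) ofPolynomial_injective)

theorem exists_norm_sub_ofPolynomial_lt (f : WeightedHardy β) {ε : ℝ} (hε : 0 < ε) :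
    ∃ P : Polynomial ℂ, ‖f - ofPolynomial β P‖ < ε := by
  have hs : Summable fun n => ‖taylorCoeff f n‖ ^ 2 * β n := f.2.2
  have hlim := hs.hasSum.tendsto_sum_nat
  obtain ⟨N, hN⟩ := (hlim.eventually (lt_mem_nhds (sub_lt_self _ (pow_pos hε 2)))).exists
  refine ⟨∑ n ∈ Finset.range N, Polynomial.monomial n (taylorCoeff f n),
    lt_of_pow_lt_pow_left₀ 2 hε.le ?_⟩
  set P := ∑ n ∈ Finset.range N, Polynomial.monomial n (taylorCoeff f n)
  have hP : ∀ n, P.coeff n = if n < N then taylorCoeff f n else 0 := fun n => by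
    simp [P, Polynomial.finsetSum_coeff, Polynomial.coeff_monomial]
  have hc : ∀ n, taylorCoeff (f - ofPolynomial β P : WeightedHardy β) n =
      taylorCoeff f n - P.coeff n := fun n => by
    refine taylorCoeff_eq_of_hasSum (a := fun n => taylorCoeff f n - P.coeff n) (fun z => ?_) n
    simp only [sub_mul]
    exact (hasSum_coeff f z).sub (hasSum_polynomial P z)
  have h1 : HasSum (fun n => if n < N then ‖taylorCoeff f n‖ ^ 2 * β n else 0)
      (∑ n ∈ Finset.range N, ‖taylorCoeff f n‖ ^ 2 * β n) := by
    have := hasSum_sum_of_ne_finset_zero (L := .unconditional ℕ) (s := Finset.range N)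
      (f := fun n => if n < N then ‖taylorCoeff f n‖ ^ 2 * β n else 0)
      fun n hn => if_neg (by simpa using hn)
    convert this using 1
    exact Finset.sum_congr rfl fun n hn => (if_pos (Finset.mem_range.1 hn)).symm
  rw [norm_sq_eq, ((hs.hasSum.sub h1).congr_fun fun n => ?_).tsum_eq]
  · linarith
  · rw [hc, hP]
    split_ifs <;> simp

end WeightedHardy

theorem exists_norm_polynomial_eval_le (P : Polynomial ℂ) : ∃ C, ∀ z : 𝔻, ‖P.eval (z : ℂ)‖ ≤ C := by
  obtain ⟨C, hC⟩ := (isCompact_closedBall (0 : ℂ) 1).exists_bound_of_continuousOn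
    P.continuous.continuousOn
  exact ⟨C, fun z => hC z (by simpa using z.norm_lt_one.le)⟩

/-! ### Composition operators -/

section Composition

variable {β : Weight}

theorem CompositionCompact.comp_left {φ a : 𝔻 → 𝔻} (hφ : CompositionCompact β φ)
    (ha : CompositionBounded β a) : CompositionCompact β fun z => a (φ z) := by
  obtain ⟨T, hT, hTc⟩ := hφ
  obtain ⟨A, hA⟩ := ha
  exact ⟨T ∘L A, fun f => by
    rw [ContinuousLinearMap.comp_apply, hT, hA]
    rfl, hTc.comp_clm A⟩

theorem CompositionCompact.comp_right {φ a : 𝔻 → 𝔻} (hφ : CompositionCompact β φ)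
    (ha : CompositionBounded β a) : CompositionCompact β fun z => φ (a z) := by
  obtain ⟨T, hT, hTc⟩ := hφ
  obtain ⟨A, hA⟩ := ha
  exact ⟨A ∘L T, fun f => by
    rw [ContinuousLinearMap.comp_apply, hA, hT]
    rfl, hTc.clm_comp A⟩

/-- The n-th coefficient is multiplied by cⁿ, so the operator is isometric for every weight. -/
theorem compositionBounded_rotation (c : Circle) : CompositionBounded β fun z => c • z := by
  have hsum : ∀ (f : WeightedHardy β) (z : 𝔻),
      HasSum (fun n => taylorCoeff f n * (c : ℂ) ^ n * (z : ℂ) ^ n) (f (c • z)) := fun f z => by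
    simpa [mul_pow, mul_assoc] using WeightedHardy.hasSum_coeff f (c • z)
  have hcoeff : ∀ f : WeightedHardy β, ∀ n,
      ‖taylorCoeff (fun z => f (c • z)) n‖ = ‖taylorCoeff f n‖ := fun f n => by
    rw [taylorCoeff_eq_of_hasSum (hsum f), norm_mul, norm_pow, Circle.norm_coe, one_pow, mul_one]
  let L : WeightedHardy β →ₗ[ℂ] WeightedHardy β :=
    { toFun := fun f => ⟨fun z => f (c • z), isAnalyticOnDisc_of_hasSum (hsum f), by
        simpa only [hcoeff] using f.2.2⟩
      map_add' := fun _ _ => rfl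
      map_smul' := fun _ _ => rfl }
  refine ⟨L.mkContinuous 1 fun f => ?_, fun f => rfl⟩
  rw [one_mul]
  refine le_of_eq ((sq_eq_sq₀ (norm_nonneg _) (norm_nonneg _)).1 ?_)
  rw [WeightedHardy.norm_sq_eq, WeightedHardy.norm_sq_eq]
  exact tsum_congr fun n => by rw [← hcoeff f]; rfl

theorem not_compositionCompact_id : ¬ CompositionCompact β fun z => z := by
  rintro ⟨T, hT, hTc⟩
  have : (T : WeightedHardy β → WeightedHardy β) = id :=
    funext fun f => WeightedHardy.ext_apply fun z => congrFun (hT f) z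
  rw [this] at hTc
  exact WeightedHardy.not_finiteDimensional (β := β) (FiniteDimensional.of_isCompactOperator_id hTc)

/-- Equality in the Schwarz lemma makes ψ a rotation. Undoing it by the inverse rotation would make
the identity operator compact. -/
theorem CompositionCompact.norm_lt_norm {ψ : 𝔻 → 𝔻} (hc : CompositionCompact β ψ)
    (hψ : IsAnalyticOnDisc fun z => (ψ z : ℂ)) (h0 : ψ 0 = 0) (z : 𝔻) (hz : z ≠ 0) :
    ‖(ψ z : ℂ)‖ < ‖(z : ℂ)‖ := by
  refine lt_of_le_of_ne (schwarz_norm_le hψ h0 z) fun h => ?_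
  obtain ⟨c, hrot⟩ := schwarz_rotation hψ h0 hz h
  refine not_compositionCompact_id (β := β) ?_
  simpa [hrot] using hc.comp_left (compositionBounded_rotation (β := β) c⁻¹)

/-! ### The boundary behaviour of a compact composition operator -/

theorem WeightedHardy.tendsto_kernelDiag (hdiv : ¬ Summable fun n => 1 / β n) {z : ℕ → 𝔻}
    (hz : Tendsto (fun k => ‖(z k : ℂ)‖) atTop (𝓝 1)) :
    Tendsto (fun k => kernelDiag β (z k)) atTop atTop := by
  rw [not_summable_iff_tendsto_nat_atTop_of_nonneg fun n => (one_div_pos.2 (β.pos n)).le] at hdiv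
  refine tendsto_atTop.2 fun B => ?_
  obtain ⟨N, hN⟩ := (hdiv.eventually_gt_atTop B).exists
  have hlim : Tendsto (fun k => ∑ n ∈ Finset.range N, ‖(z k : ℂ)‖ ^ (2 * n) / β n) atTop
      (𝓝 (∑ n ∈ Finset.range N, 1 / β n)) := by
    refine tendsto_finsetSum _ fun n _ => Tendsto.div_const ?_ _
    simpa using hz.pow (2 * n)
  filter_upwards [hlim.eventually (lt_mem_nhds hN)] with k hk
  exact hk.le.trans ((β.summable_norm_pow_div (z k)).sum_le_tsum _
    fun n _ => div_nonneg (by positivity) (β.pos n).le)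

theorem WeightedHardy.kernelDiag_mono {z w : 𝔻} (h : ‖(z : ℂ)‖ ≤ ‖(w : ℂ)‖) :
    kernelDiag β z ≤ kernelDiag β w :=
  (β.summable_norm_pow_div z).tsum_le_tsum (fun n => div_le_div_of_nonneg_right
    (pow_le_pow_left₀ (norm_nonneg _) h _) (β.pos n).le) (β.summable_norm_pow_div w)

theorem CompositionCompact.false_of_not_summable {φ : 𝔻 → 𝔻} (hc : CompositionCompact β φ)
    (hdiv : ¬ Summable fun n => 1 / β n) {z : ℕ → 𝔻}
    (hz : Tendsto (fun k => ‖(z k : ℂ)‖) atTop (𝓝 1))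
    (hle : ∀ k, ‖(z k : ℂ)‖ ≤ ‖(φ (z k) : ℂ)‖) : False := by
  obtain ⟨T, hT, hTc⟩ := hc
  choose f hf1 hf using fun k => WeightedHardy.exists_norm_le_one_apply_eq (β := β) (φ (z k))
  obtain ⟨K, hK, hKs⟩ := hTc.image_closedBall_subset_compact 1
  obtain ⟨g, -, θ, hθ, hg⟩ := hK.tendsto_subseq (x := fun k => T (f k))
    fun k => hKs ⟨f k, by simpa using hf1 k, rfl⟩
  -- With s the norm of evaluation at w, the two errors of 1/4 give s ≤ s/4 + s/4 + C, contrary to s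
  -- > 2C.
  obtain ⟨P, hP⟩ := WeightedHardy.exists_norm_sub_ofPolynomial_lt g (ε := 1 / 4) (by norm_num)
  obtain ⟨C, hC⟩ := exists_norm_polynomial_eval_le P
  have hS := Real.tendsto_sqrt_atTop.comp
    ((WeightedHardy.tendsto_kernelDiag hdiv hz).comp hθ.tendsto_atTop)
  have hev := (tendsto_iff_norm_sub_tendsto_zero.1 hg).eventually
    (gt_mem_nhds (show (0 : ℝ) < 1 / 4 by norm_num))
  obtain ⟨k, h1, h2⟩ := (hev.and (hS.eventually_gt_atTop (2 * C))).exists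
  simp only [Function.comp_apply] at h1 h2
  set w := z (θ k)
  set s := √(kernelDiag β w)
  have e1 : s ≤ ‖T (f (θ k)) w‖ := by
    rw [hT, Function.comp_apply, hf, Complex.norm_of_nonneg (Real.sqrt_nonneg _)]
    exact Real.sqrt_le_sqrt (WeightedHardy.kernelDiag_mono (hle _))
  have e2 := WeightedHardy.norm_apply_le (T (f (θ k)) - g) w
  have e3 := WeightedHardy.norm_apply_le (g - WeightedHardy.ofPolynomial β P) w
  have e4 := hC w
  have e5 : T (f (θ k)) w = (T (f (θ k)) - g) w + (g - WeightedHardy.ofPolynomial β P) w +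
      P.eval (w : ℂ) := by
    simp only [WeightedHardy.sub_apply, WeightedHardy.ofPolynomial_apply]
    ring
  have e6 : ‖T (f (θ k)) w‖ ≤ ‖(T (f (θ k)) - g) w‖ +
      ‖(g - WeightedHardy.ofPolynomial β P) w‖ + ‖P.eval (w : ℂ)‖ := by
    rw [e5]
    exact norm_add₃_le
  have hs : 0 ≤ s := Real.sqrt_nonneg _
  nlinarith

/-- Evaluations are bounded by √(∑ 1/β_n) on all of 𝔻, so polynomials approximate f uniformly and
their continuity at ζ transfers to f. -/
theorem WeightedHardy.tendsto_sub_apply (hsum : Summable fun n => 1 / β n) (f : WeightedHardy β)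
    {z w : ℕ → 𝔻} {ζ : ℂ} (hz : Tendsto (fun k => (z k : ℂ)) atTop (𝓝 ζ))
    (hw : Tendsto (fun k => (w k : ℂ)) atTop (𝓝 ζ)) :
    Tendsto (fun k => f (w k) - f (z k)) atTop (𝓝 0) := by
  set B := √(∑' n, 1 / β n)
  have hB : ∀ u : 𝔻, √(kernelDiag β u) ≤ B := fun u => Real.sqrt_le_sqrt <|
    (β.summable_norm_pow_div u).tsum_le_tsum (fun n => div_le_div_of_nonneg_right
      (pow_le_one₀ (norm_nonneg _) u.norm_lt_one.le) (β.pos n).le) hsum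
  have hB0 : 0 ≤ B := Real.sqrt_nonneg _
  rw [Metric.tendsto_nhds]
  intro ε hε
  obtain ⟨P, hP⟩ := f.exists_norm_sub_ofPolynomial_lt (ε := ε / (4 * (B + 1))) (by positivity)
  have hlim : Tendsto (fun k => P.eval (w k : ℂ) - P.eval (z k : ℂ)) atTop (𝓝 0) := by
    simpa using ((P.continuous.tendsto ζ).comp hw).sub ((P.continuous.tendsto ζ).comp hz)
  filter_upwards [Metric.tendsto_nhds.1 hlim (ε / 2) (by positivity)] with k hk
  rw [dist_zero_right] at hk ⊢
  have hle : ∀ u, ‖(f - ofPolynomial β P) u‖ ≤ ε / 4 := fun u => by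
    calc _ ≤ ‖f - ofPolynomial β P‖ * √(kernelDiag β u) := norm_apply_le _ u
      _ ≤ ε / (4 * (B + 1)) * (B + 1) := by
        refine mul_le_mul hP.le ((hB u).trans (by linarith)) (Real.sqrt_nonneg _) (by positivity)
      _ = ε / 4 := by field_simp
  have e : f (w k) - f (z k) = (f - ofPolynomial β P) (w k) - (f - ofPolynomial β P) (z k) +
      (P.eval (w k : ℂ) - P.eval (z k : ℂ)) := by
    simp only [sub_apply, ofPolynomial_apply]
    ring
  rw [e]
  have h1 := norm_add_le ((f - ofPolynomial β P) (w k) - (f - ofPolynomial β P) (z k))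
    (P.eval (w k : ℂ) - P.eval (z k : ℂ))
  have h2 := norm_sub_le ((f - ofPolynomial β P) (w k)) ((f - ofPolynomial β P) (z k))
  linarith [hle (w k), hle (z k)]

/-- Constants make 1 an eigenvalue of C_ψ. Subtracting the rank-one map f ↦ f(0) removes it, and the
Fredholm alternative then gives surjectivity. -/
theorem CompositionCompact.exists_comp_sub_eq {ψ : 𝔻 → 𝔻} (hc : CompositionCompact β ψ)
    (hψ : IsAnalyticOnDisc fun z => (ψ z : ℂ)) (h0 : ψ 0 = 0) (g : WeightedHardy β) (hg : g 0 = 0) :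
    ∃ f : WeightedHardy β, ∀ z, f (ψ z) - f z = g z := by
  have hlt := hc.norm_lt_norm hψ h0
  have hcont := continuous_of_isAnalyticOnDisc_coe hψ
  obtain ⟨T, hT, hTc⟩ := hc
  have hT' : ∀ f z, T f z = f (ψ z) := fun f z => congrFun (hT f) z
  let R : WeightedHardy β →L[ℂ] WeightedHardy β :=
    (WeightedHardy.eval 0).smulRight (WeightedHardy.ofPolynomial β 1)
  have hR : ∀ f z, R f z = f 0 := fun f z => by
    simp [R, WeightedHardy.smul_apply, WeightedHardy.eval_apply, WeightedHardy.ofPolynomial_apply]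
  have hRc : IsCompactOperator R :=
    (isCompactOperator_of_locallyCompactSpace_rng
      (ContinuousLinearMap.toSpanSingleton ℂ (WeightedHardy.ofPolynomial β 1))).comp_clm
      (WeightedHardy.eval 0)
  have hTR : IsCompactOperator (T - R) := hTc.sub hRc
  rcases hTR.hasEigenvalue_or_mem_resolventSet one_ne_zero with h | h
  · obtain ⟨f, hf⟩ := h.exists_hasEigenvector
    have hf1 : ∀ z, f (ψ z) - f 0 = f z := fun z => by
      have := congrArg (fun u : WeightedHardy β => u z) hf.apply_eq_smul
      simpa [WeightedHardy.sub_apply, hT', hR] using this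
    -- An eigenvector for 1 vanishes at 0, hence is ψ-invariant, hence equals its limit f(0) = 0
    -- along orbits.
    have hf0 : f 0 = 0 := by
      rw [← hf1 0, h0, sub_self]
    have hiter : ∀ n z, f (ψ^[n] z) = f z := fun n z => by
      induction n with
      | zero => rfl
      | succ n ih => rw [Function.iterate_succ_apply', ← ih, ← hf1 (ψ^[n] z), hf0, sub_zero]
    refine absurd (WeightedHardy.ext_apply fun z => ?_) hf.2
    have h1 : Tendsto (fun n => ψ^[n] z) atTop (𝓝 0) := by
      rw [Complex.UnitDisc.isEmbedding_coe.tendsto_nhds_iff]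
      exact tendsto_zero_iff_norm_tendsto_zero.2 (tendsto_iterate_zero hcont hlt h0 z)
    have h2 := (f.2.1.continuous.tendsto 0).comp h1
    have h3 : Tendsto (fun _ : ℕ => f z) atTop (𝓝 (f 0)) := h2.congr fun n => hiter n z
    exact (tendsto_nhds_unique tendsto_const_nhds h3).trans hf0
  · rw [spectrum.mem_resolventSet_iff, ContinuousLinearMap.isUnit_iff_bijective] at h
    obtain ⟨f, hf⟩ := h.2 (-g)
    have hf1 : ∀ z, f z - (f (ψ z) - f 0) = -g z := fun z => by
      have := congrArg (fun u : WeightedHardy β => u z) hf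
      simpa [WeightedHardy.sub_apply, WeightedHardy.neg_apply, hT', hR] using this
    -- At 0 the equation reads f(0) = −g(0) = 0, so the rank-one correction drops out.
    have hf0 : f 0 = 0 := by simpa [h0, hg] using hf1 0
    refine ⟨f, fun z => ?_⟩
    have := hf1 z
    rw [hf0] at this
    linear_combination -this

theorem CompositionCompact.false_of_summable {φ : 𝔻 → 𝔻} (hc : CompositionCompact β φ)
    (hβ : DiscAutomorphismInvariant β) (hφ : IsAnalyticOnDisc fun z => (φ z : ℂ))
    (hsum : Summable fun n => 1 / β n) {z : ℕ → 𝔻} {ζ : ℂ} (hζ : ‖ζ‖ = 1)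
    (hz : Tendsto (fun k => (z k : ℂ)) atTop (𝓝 ζ))
    (hφz : Tendsto (fun k => (φ (z k) : ℂ)) atTop (𝓝 ζ)) : False := by
  set a := -φ 0
  have hden := one_add_conj_mul_ne_zero a hζ.le
  set η := ((a : ℂ) + ζ) / (1 + conj (a : ℂ) * ζ)
  have hη : ‖η‖ = 1 := by
    have h1 : (a : ℂ) + ζ = ζ * conj (1 + conj (a : ℂ) * ζ) := by
      have : ζ * conj ζ = 1 := by rw [Complex.mul_conj, Complex.normSq_eq_norm_sq, hζ]; simp
      simp only [map_add, map_one, map_mul, Complex.conj_conj]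
      linear_combination -(a : ℂ) * this
    rw [norm_div, h1, norm_mul, RCLike.norm_conj, hζ, one_mul, div_self (norm_ne_zero_iff.2 hden)]
  have hη0 : η ≠ 0 := norm_ne_zero_iff.1 (by rw [hη]; exact one_ne_zero)
  -- The automorphism sends φ(0) to 0 but ζ to η. The rotation by ζ/η brings η back to ζ and keeps
  -- 0.
  obtain ⟨c, hcη⟩ : ∃ c : Circle, (c : ℂ) = ζ / η :=
    ⟨⟨ζ / η, mem_sphere_zero_iff_norm.2 (by rw [norm_div, hζ, hη, div_one])⟩, rfl⟩
  set ψ : 𝔻 → 𝔻 := fun z => c • discAut a (φ z)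
  have hψc : CompositionCompact β ψ :=
    (hc.comp_left (hβ a)).comp_left (compositionBounded_rotation c)
  have hψ0 : ψ 0 = 0 := by
    rw [← Complex.UnitDisc.coe_inj]
    simp [ψ, a, discAut_neg_apply_self]
  have hψ : IsAnalyticOnDisc fun z => (ψ z : ℂ) := by
    simp only [ψ, Complex.UnitDisc.coe_circle_smul]
    have h1 : IsAnalyticOnDisc fun u : 𝔻 => (c : ℂ) * u :=
      isAnalyticOnDisc_of_eq (F := fun u => (c : ℂ) * u) (by fun_prop) fun _ => rfl
    exact h1.comp (φ := fun z => discAut a (φ z)) ((isAnalyticOnDisc_discAut a).comp hφ)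
  have hlim : Tendsto (fun k => (ψ (z k) : ℂ)) atTop (𝓝 ζ) := by
    have h1 : Tendsto (fun k => (c : ℂ) * (((a : ℂ) + φ (z k)) / (1 + conj (a : ℂ) * φ (z k))))
        atTop (𝓝 ((c : ℂ) * η)) :=
      ((hφz.const_add _).div ((hφz.const_mul _).const_add _) hden).const_mul _
    rw [hcη, div_mul_cancel₀ _ hη0] at h1
    simpa [ψ, coe_discAut, hcη] using h1
  obtain ⟨f, hf⟩ := hψc.exists_comp_sub_eq hψ hψ0 (WeightedHardy.ofPolynomial β Polynomial.X)
    (by simp [WeightedHardy.ofPolynomial_apply])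
  have h1 := WeightedHardy.tendsto_sub_apply hsum f hz hlim
  simp only [hf, WeightedHardy.ofPolynomial_apply, Polynomial.eval_X] at h1
  rw [tendsto_nhds_unique hz h1, norm_zero] at hζ
  exact zero_ne_one hζ

/-! ### Existence of the interior fixed point, and convergence of the iterates. -/

theorem CompositionCompact.exists_fixed_point {φ : 𝔻 → 𝔻} (hc : CompositionCompact β φ)
    (hβ : DiscAutomorphismInvariant β) (hφ : IsAnalyticOnDisc fun z => (φ z : ℂ)) :
    ∃ p, φ p = p := by
  have hr : ∀ k : ℕ, ‖(((k : ℝ) / (k + 1) : ℝ) : ℂ)‖ < 1 := fun k => by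
    rw [Complex.norm_of_nonneg (by positivity), div_lt_one (by positivity)]
    linarith
  choose p hp using fun k => exists_mul_apply_eq_self hφ (r := Complex.UnitDisc.mk _ (hr k))
    (by rw [Complex.UnitDisc.coe_mk, Complex.conj_ofReal])
  have hpe : ∀ k : ℕ, (((k : ℝ) / (k + 1) : ℝ) : ℂ) * φ (p k) = p k := fun k => by
    have := congrArg ((↑) : 𝔻 → ℂ) (hp k)
    rwa [Complex.UnitDisc.coe_mul, Complex.UnitDisc.coe_mk] at this
  obtain ⟨ζ, hζ, θ, hθ, hlim⟩ := (isCompact_closedBall (0 : ℂ) 1).tendsto_subseq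
    (x := fun k => (p k : ℂ)) fun k => by simpa using (p k).norm_lt_one.le
  have hrlim : Tendsto (fun k : ℕ => (((k : ℝ) / (k + 1) : ℝ) : ℂ)) atTop (𝓝 1) := by
    have := (Complex.continuous_ofReal.tendsto 1).comp (tendsto_natCast_div_add_atTop (𝕜 := ℝ) 1)
    simpa [Function.comp_def] using this
  have hφlim : Tendsto (fun k => (φ (p (θ k)) : ℂ)) atTop (𝓝 ζ) := by
    have h1 := hlim.div (hrlim.comp hθ.tendsto_atTop) one_ne_zero
    rw [div_one] at h1
    refine h1.congr' ?_
    filter_upwards [(hrlim.comp hθ.tendsto_atTop).eventually_ne one_ne_zero] with k hk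
    simp only [Pi.div_apply, Function.comp_apply] at hk ⊢
    rw [div_eq_iff hk, mul_comm, hpe]
  rcases (mem_closedBall_zero_iff.1 hζ).lt_or_eq with h | h
  · refine ⟨Complex.UnitDisc.mk ζ h, ?_⟩
    have h1 : Tendsto (fun k => p (θ k)) atTop (𝓝 (Complex.UnitDisc.mk ζ h)) :=
      Complex.UnitDisc.isEmbedding_coe.tendsto_nhds_iff.2 hlim
    have h2 := (hφ.continuous.tendsto _).comp h1
    rw [← Complex.UnitDisc.coe_inj]
    exact tendsto_nhds_unique h2 hφlim
  · exfalso
    by_cases hsum : Summable fun n => 1 / β n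
    · exact hc.false_of_summable hβ hφ hsum h hlim hφlim
    · refine hc.false_of_not_summable hsum (z := fun k => p (θ k)) (by simpa [h] using hlim.norm)
        fun k => ?_
      -- From p_k = r_k φ(p_k) with 0 ≤ r_k < 1 it follows that |p_k| ≤ |φ(p_k)|.
      rw [← hpe (θ k), norm_mul]
      exact mul_le_of_le_one_left (norm_nonneg _) (hr _).le

end Composition

theorem mainTheorem8 (β : Weight) (hβ : DiscAutomorphismInvariant β)
    (φ : 𝔻 → 𝔻) (hφ : IsSymbol φ) (hc : CompositionCompact β φ) :
    ∃ p : 𝔻, IsDenjoyWolffPoint φ (p : ℂ) ∧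
      (∀ q : ℂ, IsDenjoyWolffPoint φ q → q = (p : ℂ)) ∧ φ p = p := by
  obtain ⟨p, hp⟩ := hc.exists_fixed_point hβ hφ.analytic
  have hψ : IsAnalyticOnDisc fun u => (discAut (-p) (φ (discAut p u)) : ℂ) :=
    (isAnalyticOnDisc_discAut (-p)).comp (φ := fun u => φ (discAut p u))
      (hφ.analytic.comp (isAnalyticOnDisc_discAut p))
  have hψ0 : discAut (-p) (φ (discAut p 0)) = 0 := by
    rw [discAut_apply_zero, hp, discAut_neg_apply_self]
  have hψc : CompositionCompact β fun u => discAut (-p) (φ (discAut p u)) :=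
    (hc.comp_right (hβ p)).comp_left (hβ (-p))
  have hlim := tendstoLocallyUniformly_iterate_conj (tendstoLocallyUniformly_iterate_zero
    (continuous_of_isAnalyticOnDisc_coe hψ) (hψc.norm_lt_norm hψ hψ0) hψ0)
  refine ⟨p, ⟨p.norm_lt_one.le, hlim⟩, fun q hq => ?_, hp⟩
  exact tendsto_nhds_unique 
    ((tendstoLocallyUniformlyOn_univ.2 hq.2).tendsto_at (Set.mem_univ 0))
    ((tendstoLocallyUniformlyOn_univ.2 hlim).tendsto_at (Set.mem_univ 0))

end
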